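/- Fix a number of items $n\ge 1$. An outcome is a pair $(x;p)\in[0,1]^n\times[0,\infty)$ (item $i$ is allocated with probability $x_i$, for total price $p$), and a buyer of type $v\in[0,\infty)^n$ has utility $\sum_{i=1}^n x_iv_i-p$ from it. An (incentive-compatible and individually rational) auction is a possibly infinite menu $\mathcal M\subseteq[0,1]^n\times[0,\infty)$ that contains $(0;0)$ and in which every type $v\in[0,\infty)^n$ has a utility-maximizing entry; its menu size is the number of its entries other than $(0;0)$. Its revenue $\mathrm{Rev}_{\mathcal M}(F)\in[0,\infty]$ from a distribution $F$ on $[0,\infty)^n$ is the expectation over $v\sim F$ of the highest price (supremum of the prices) of a utility-maximizing entry for $v$. Let $\mathrm{Rev}(F)$ be the supremum of $\mathrm{Rev}_{\mathcal M}(F)$ over all auctions $\mathcal M$, and $\mathrm{Rev}_C(F)$ the supremum over all auctions of menu size at most $C$. For $H\ge 0$ let $\mathcal{EU}^n_H=\{v\in[0,\infty)^n : |\{i : v_i>H\}|\le 1\}$. **Proposition.** There is a universal constant $K\in\mathbb N$ such that for every integer $n\ge1$, every $H\ge0$ and every $\varepsilon>0$ there is an integer $C=C(n,H,\varepsilon)\ge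 0$ with $$C\le\left(\frac{n\cdot\max\{1,H\}}{\varepsilon}\right)^{K n}$$ such that for every (possibly correlated) probability distribution $F$ supported on $\mathcal{EU}^n_H$, $$\mathrm{Rev}_C(F)\ \ge\ (1-\varepsilon)\cdot\mathrm{Rev}(F)-\varepsilon .$$ (If $\mathrm{Rev}(F)=\infty$ and $\varepsilon<1$, this says that $\mathrm{Rev}_C(F)=\infty$; for $\varepsilon\ge1$ the inequality is trivial.) -/

import Mathlib

open scoped ENNReal

namespace MenuAuction

noncomputable section

/-- An outcome `(x; p)`: item `i` is allocated with probability `x i`, for a total price `p`. -/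
abbrev Outcome (n : ℕ) : Type := (Fin n → ℝ) × ℝ

/-- The legal outcomes: `[0,1]^n × [0,∞)`. -/
def outcomes (n : ℕ) : Set (Outcome n) :=
  {e | (∀ i, 0 ≤ e.1 i ∧ e.1 i ≤ 1) ∧ 0 ≤ e.2}

/-- Utility of a risk-neutral additive buyer of type `v` from the outcome `e`. -/
def utility {n : ℕ} (e : Outcome n) (v : Fin n → ℝ) : ℝ :=
  ∑ i, e.1 i * v i - e.2

/-- The entries of the menu `M` that maximize the utility of type `v` over `M`. -/
def favorites {n : ℕ} (M : Set (Outcome n)) (v : Fin n → ℝ) : Set (Outcome n) :=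
  {e | e ∈ M ∧ ∀ f ∈ M, utility f v ≤ utility e v}

/-- `M` is the menu of an incentive-compatible, individually rational auction: a (possibly
infinite) set of outcomes that contains `(0; 0)` and in which every nonnegative type has a
utility-maximizing entry. -/
def IsAuction {n : ℕ} (M : Set (Outcome n)) : Prop :=
  M ⊆ outcomes n ∧ (0 : Outcome n) ∈ M ∧
    ∀ v : Fin n → ℝ, (∀ i, 0 ≤ v i) → (favorites M v).Nonempty

/-- The number of entries of the menu `M`, not counting `(0; 0)`. -/
def menuSize {n : ℕ} (M : Set (Outcome n)) : ℕ∞ :=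
  (M \ {0}).encard

/-- The price paid by type `v`: the highest price (supremum of the prices) of a
utility-maximizing entry. -/
def payment {n : ℕ} (M : Set (Outcome n)) (v : Fin n → ℝ) : ℝ≥0∞ :=
  ⨆ e ∈ favorites M v, ENNReal.ofReal e.2

/-- The expected revenue of the menu `M` when the type is distributed according to `F`. -/
def revOf {n : ℕ} (M : Set (Outcome n)) (F : MeasureTheory.Measure (Fin n → ℝ)) : ℝ≥0∞ :=
  ∫⁻ v, payment M v ∂F

/-- The supremum of the revenues obtainable from `F` by auctions of menu size at most `C`. -/
def RevC {n : ℕ} (C : ℕ) (F : MeasureTheory.Measure (Fin n → ℝ)) : ℝ≥0∞ :=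
  ⨆ (M : Set (Outcome n)) (_ : IsAuction M) (_ : menuSize M ≤ (C : ℕ∞)), revOf M F

/-- The supremum of the revenues obtainable from `F` by arbitrary auctions. -/
def Rev {n : ℕ} (F : MeasureTheory.Measure (Fin n → ℝ)) : ℝ≥0∞ :=
  ⨆ (M : Set (Outcome n)) (_ : IsAuction M), revOf M F

/-- The exclusively unbounded valuations: nonnegative vectors with at most one coordinate
greater than `H`. -/
def exclusivelyUnbounded (n : ℕ) (H : ℝ) : Set (Fin n → ℝ) :=
  {v | (∀ i, 0 ≤ v i) ∧ {i | H < v i}.encard ≤ 1}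

end

end MenuAuction

namespace MenuAuction

open MeasureTheory Set Filter Topology

/-! Replace a menu by its closure, so that favorites of maximal price exist and their price is
measurable in the type. Geometric price bands give a wide gap between two thresholds E and E₁
carrying only a small fraction of the revenue (`exists_band_le`); that band is discarded.

Types paying less than E are served by a finite rounding of the menu. Prices are rounded
geometrically and allocations to a grid, except in one coordinate, whose value may be unbounded;
there each cell is represented by an outcome maximizing that coordinate. Discounting all prices by 1
- η makes expensive entries relatively more attractive, so rounding cannot push a type to a much
cheaper entry (`le_price_of_mem_favorites_discountMenu`).

Types paying at least E₁ have exactly one large value, say for item i. Up to an error n * H they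
face a one-dimensional problem. If s is the largest share of item i in the rounded menu, what
remains to be sold is the share 1 - s, of value (1 - s) * v i. The approximate Myerson lemma shows
that one posted price for item i nearly suffices (`lintegral_expensiveAt_le`). These prices exceed E
and act on disjoint sets of types, so the rounded menu plus n single-item entries earns both parts
(`le_revOf_discountMenu`). -/

/-! ### One-dimensional mechanisms and posted prices. -/

/-- Approximate Myerson lemma: if the choices `(y, q)` of one-dimensional types `z ≥ z₀` are
incentive compatible up to `c`, then their revenue is, up to the factor `r` and the loss
`c * (r / (r - 1))`, bounded by the revenue of posting a single price. -/
theorem lintegral_le_of_approx_incentive_compatible {X : Type*} [MeasurableSpace X]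
    (μ : Measure X) {s : Set X} (hs : MeasurableSet s) {z y q : X → ℝ} (hz : Measurable z)
    {c r z₀ : ℝ} (hc : 0 ≤ c) (hr : 1 < r) (hz₀ : 0 < z₀) (hzs : ∀ v ∈ s, z₀ ≤ z v)
    (hy0 : ∀ v ∈ s, 0 ≤ y v) (hy1 : ∀ v ∈ s, y v ≤ 1) (hq : ∀ v ∈ s, 0 ≤ q v)
    (hIR : ∀ v ∈ s, q v ≤ y v * z v)
    (hIC : ∀ v ∈ s, ∀ w ∈ s, y w * z v - q w - c ≤ y v * z v - q v)
    {G : ℝ≥0∞} (hG : ∀ t, z₀ ≤ t → ENNReal.ofReal t * μ (s ∩ {v | t ≤ z v}) ≤ G) :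
    ∫⁻ v in s, ENNReal.ofReal (q v - c * (r / (r - 1))) ∂μ ≤ ENNReal.ofReal r * G := by
  have hr1 : 0 < r - 1 := by linarith
  have hr0 : 0 < r := by linarith
  obtain rfl | ⟨v₀, hv₀⟩ := s.eq_empty_or_nonempty
  · simp
  have : Nonempty s := ⟨⟨v₀, hv₀⟩⟩
  set b : ℝ → ℝ := fun x => ⨆ w : s, max 0 (y w * x - q w) with hb
  have hbdd : ∀ x, 0 ≤ x → BddAbove (range fun w : s => max 0 (y w * x - q w)) := by
    intro x hx
    refine ⟨x, ?_⟩
    rintro _ ⟨w, rfl⟩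
    refine max_le hx ?_
    nlinarith [hy1 w w.2, hq w w.2, mul_le_of_le_one_left hx (hy1 w w.2)]
  have hle : ∀ x, 0 ≤ x → ∀ w ∈ s, y w * x - q w ≤ b x := fun x hx w hw =>
    (le_max_right _ _).trans (le_ciSup (hbdd x hx) ⟨w, hw⟩)
  have hb0 : ∀ x, 0 ≤ x → 0 ≤ b x := fun x hx =>
    (le_max_left _ _).trans (le_ciSup (hbdd x hx) ⟨v₀, hv₀⟩)
  have hbz : ∀ v ∈ s, b (z v) ≤ y v * z v - q v + c := by
    intro v hv
    refine ciSup_le fun w => max_le ?_ ?_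
    · linarith [hIR v hv]
    · linarith [hIC v hv w w.2]
  have hbmono : ∀ x x', 0 ≤ x → x ≤ x' → b x ≤ b x' := by
    intro x x' hx hxx
    refine ciSup_le fun w => max_le (hb0 _ (hx.trans hxx)) ?_
    have := hle x' (hx.trans hxx) w w.2
    nlinarith [mul_le_mul_of_nonneg_left hxx (hy0 w w.2)]
  have hblip : ∀ x x', 0 ≤ x → x ≤ x' → b x' ≤ b x + (x' - x) := by
    intro x x' hx hxx
    refine ciSup_le fun w => max_le (by linarith [hb0 x hx]) ?_
    have := hle x hx w w.2
    nlinarith [mul_le_of_le_one_left (sub_nonneg.2 hxx) (hy1 w w.2)]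
  have hconv : ConvexOn ℝ (Ici 0) b := by
    refine ⟨convex_Ici 0, fun x hx x' hx' α β hα hβ hαβ => ?_⟩
    simp only [smul_eq_mul, mem_Ici] at *
    refine ciSup_le fun w => max_le
      (add_nonneg (mul_nonneg hα (hb0 x hx)) (mul_nonneg hβ (hb0 x' hx'))) ?_
    have h1 := mul_le_mul_of_nonneg_left (hle x hx w w.2) hα
    have h2 := mul_le_mul_of_nonneg_left (hle x' hx' w w.2) hβ
    have h3 : y w * (α * x + β * x') - q w =
        α * (y w * x - q w) + β * (y w * x' - q w) := by
      linear_combination (q w) * hαβ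
    linarith
  set ζ : ℕ → ℝ := fun j => z₀ * r ^ j with hζ
  have hζ0 : ∀ j, 0 < ζ j := fun j => mul_pos hz₀ (pow_pos hr0 j)
  have hζs : ∀ j, ζ (j + 1) = r * ζ j := fun j => by simp only [hζ]; ring
  have hζlt : ∀ j, ζ j < ζ (j + 1) := fun j => by
    rw [hζs]; nlinarith [hζ0 j]
  have hζmono : StrictMono ζ := strictMono_nat_of_lt_succ hζlt
  have hζz : ∀ j, z₀ ≤ ζ j := fun j => by
    have := hζmono.monotone (Nat.zero_le j)
    simpa [hζ] using this
  -- Chord slopes of `b` on a geometric grid play the role of the allocation: they increase within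
  -- [0, 1], so their increments `a` are weights of a randomized posted price.
  set D : ℕ → ℝ := fun j => (b (ζ (j + 1)) - b (ζ j)) / (ζ (j + 1) - ζ j) with hD
  have hDmul : ∀ j, D j * (ζ (j + 1) - ζ j) = b (ζ (j + 1)) - b (ζ j) := fun j =>
    div_mul_cancel₀ _ (sub_pos.2 (hζlt j)).ne'
  have hD1 : ∀ j, D j ≤ 1 := fun j => by
    rw [hD]
    refine (div_le_one (sub_pos.2 (hζlt j))).2 ?_
    linarith [hblip _ _ (hζ0 j).le (hζlt j).le]
  have hD0 : 0 ≤ D 0 := div_nonneg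
    (sub_nonneg.2 (hbmono _ _ (hζ0 0).le (hζlt 0).le)) (sub_pos.2 (hζlt 0)).le
  have hDmono : ∀ j, D j ≤ D (j + 1) := fun j =>
    hconv.slope_mono_adjacent (mem_Ici.2 (hζ0 _).le) (mem_Ici.2 (hζ0 _).le) (hζlt j)
      (hζlt (j + 1))
  set a : ℕ → ℝ := fun j => Nat.rec (D 0) (fun k _ => D (k + 1) - D k) j with ha
  have ha0 : a 0 = D 0 := rfl
  have has : ∀ k, a (k + 1) = D (k + 1) - D k := fun _ => rfl
  have hapos : ∀ j, 0 ≤ a j := by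
    rintro (_ | k)
    · exact hD0
    · rw [has]; linarith [hDmono k]
  have hasum : ∀ k, ∑ j ∈ Finset.range (k + 1), a j = D k := by
    intro k
    induction k with
    | zero => simp [ha0]
    | succ k ih => rw [Finset.sum_range_succ, ih, has]; ring
  -- Abel summation: the discrete form of Myerson's payment x * b'(x) - b(x).
  have habel : ∀ k, ∑ j ∈ Finset.range (k + 1), ζ j * a j = ζ k * D k - b (ζ k) + b (ζ 0) := by
    intro k
    induction k with
    | zero => simp [ha0]
    | succ k ih => rw [Finset.sum_range_succ, ih, has]; linarith [hDmul k]
  -- A type in [ζ k, ζ (k + 1)) needs the weights up to index k + 1. Moving each price one grid step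
  -- down, at the cost of a factor `r`, makes it affordable to that type.
  set θ : ℕ → ℝ := fun j => Nat.rec z₀ (fun k _ => ζ k) j with hθ
  have hθ0 : θ 0 = z₀ := rfl
  have hθs : ∀ k, θ (k + 1) = ζ k := fun _ => rfl
  have hθz : ∀ j, z₀ ≤ θ j := by
    rintro (_ | k)
    · exact le_rfl
    · exact hζz k
  have hζθ : ∀ j, ζ j ≤ r * θ j := by
    rintro (_ | k)
    · rw [hθ0]; simp only [hζ, pow_zero, mul_one]; nlinarith
    · rw [hθs, hζs]
  have hpt : ∀ v ∈ s, ENNReal.ofReal (q v - c * (r / (r - 1))) ≤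
      ∑' j, ({v | θ j ≤ z v}).indicator (fun _ => ENNReal.ofReal (ζ j * a j)) v := by
    intro v hv
    obtain ⟨k, hk1, hk2⟩ := exists_nat_pow_near
      (show 1 ≤ z v / z₀ from (one_le_div hz₀).2 (hzs v hv)) hr
    have hk1 : ζ k ≤ z v := by rw [le_div_iff₀ hz₀] at hk1; simp only [hζ]; linarith
    have hk2 : z v < ζ (k + 1) := by rw [div_lt_iff₀ hz₀] at hk2; simp only [hζ]; linarith
    have hzv : 0 < z v := hz₀.trans_le (hzs v hv)
    set x1 := ζ (k + 1) with hx1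
    set x2 := ζ (k + 1 + 1) with hx2
    have h12 : x1 < x2 := hζlt _
    have hDk := hDmul (k + 1)
    have hx0 : 0 < x1 := hζ0 _
    have hx21 : x2 - x1 = (r - 1) * x1 := by rw [hx2, hζs]; ring
    have s1 : b x1 - b (z v) ≤ D (k + 1) * (x1 - z v) := by
      have := hconv.slope_mono_adjacent (mem_Ici.2 hzv.le) (mem_Ici.2 (hζ0 _).le) hk2 h12
      exact (div_le_iff₀ (sub_pos.2 hk2)).1 this
    have s2 : y v * (x2 - z v) - c ≤ D (k + 1) * (x2 - z v) := by
      have h1 := hle x2 (hζ0 _).le v hv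
      have h2 := hbz v hv
      nlinarith
    -- Using the chord one cell beyond `z v` gives x2 - z v ≥ (r - 1) * z v, so the error `c` in the
    -- slope comparison is only magnified by 1 / (r - 1).
    have s3 : (y v - D (k + 1)) * z v ≤ c / (r - 1) := by
      rw [le_div_iff₀ hr1]
      by_cases hneg : y v - D (k + 1) ≤ 0
      · exact (mul_nonpos_of_nonpos_of_nonneg (mul_nonpos_of_nonpos_of_nonneg hneg hzv.le)
          hr1.le).trans hc
      · push Not at hneg
        have h4 : z v * (r - 1) ≤ x2 - z v := by nlinarith
        nlinarith [mul_le_mul_of_nonneg_left h4 hneg.le]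
    have hcr : c * (r / (r - 1)) = c + c / (r - 1) := by field_simp; ring
    have hmain : q v - c * (r / (r - 1)) ≤ ∑ j ∈ Finset.range (k + 1 + 1), ζ j * a j := by
      rw [habel, hcr]
      have h5 := hbz v hv
      have h6 := hb0 _ (hζ0 0).le
      nlinarith
    calc ENNReal.ofReal (q v - c * (r / (r - 1)))
        ≤ ENNReal.ofReal (∑ j ∈ Finset.range (k + 1 + 1), ζ j * a j) :=
          ENNReal.ofReal_le_ofReal hmain
      _ = ∑ j ∈ Finset.range (k + 1 + 1), ENNReal.ofReal (ζ j * a j) :=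
          ENNReal.ofReal_sum_of_nonneg fun j _ => mul_nonneg (hζ0 j).le (hapos j)
      _ = ∑ j ∈ Finset.range (k + 1 + 1),
            ({v | θ j ≤ z v}).indicator (fun _ => ENNReal.ofReal (ζ j * a j)) v := by
          refine Finset.sum_congr rfl fun j hj => ?_
          rw [indicator_of_mem]
          rcases j with _ | j
          · exact hzs v hv
          · refine (hζmono.monotone ?_).trans hk1
            have := Finset.mem_range.1 hj
            omega
      _ ≤ _ := ENNReal.sum_le_tsum _
  have hmeas : ∀ t, MeasurableSet {v | t ≤ z v} := fun t => measurableSet_le measurable_const hz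
  calc ∫⁻ v in s, ENNReal.ofReal (q v - c * (r / (r - 1))) ∂μ
      ≤ ∫⁻ v in s, ∑' j, ({v | θ j ≤ z v}).indicator
          (fun _ => ENNReal.ofReal (ζ j * a j)) v ∂μ := setLIntegral_mono' hs hpt
    _ = ∑' j, ∫⁻ v in s, ({v | θ j ≤ z v}).indicator
          (fun _ => ENNReal.ofReal (ζ j * a j)) v ∂μ :=
        lintegral_tsum fun j => (measurable_const.indicator (hmeas _)).aemeasurable
    _ ≤ ∑' j, ENNReal.ofReal (a j) * (ENNReal.ofReal r * G) := by
        refine ENNReal.tsum_le_tsum fun j => ?_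
        rw [lintegral_indicator_const (hmeas _), Measure.restrict_apply (hmeas _), inter_comm,
          mul_comm (ζ j), ENNReal.ofReal_mul (hapos j), mul_assoc]
        refine mul_le_mul' le_rfl ?_
        calc ENNReal.ofReal (ζ j) * μ (s ∩ {v | θ j ≤ z v})
            ≤ ENNReal.ofReal (r * θ j) * μ (s ∩ {v | θ j ≤ z v}) := by
              gcongr
              exact hζθ j
          _ = ENNReal.ofReal r * (ENNReal.ofReal (θ j) * μ (s ∩ {v | θ j ≤ z v})) := by
              rw [ENNReal.ofReal_mul hr0.le, mul_assoc]
          _ ≤ _ := mul_le_mul' le_rfl (hG _ (hθz j))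
    _ = (∑' j, ENNReal.ofReal (a j)) * (ENNReal.ofReal r * G) := ENNReal.tsum_mul_right
    _ ≤ 1 * (ENNReal.ofReal r * G) := by
        gcongr
        refine ENNReal.tsum_le_of_sum_range_le fun k => ?_
        rcases k with _ | k
        · simp
        · rw [← ENNReal.ofReal_sum_of_nonneg fun j _ => hapos j, hasum]
          exact ENNReal.ofReal_le_one.2 (hD1 k)
    _ = _ := one_mul _

/-! ### Closed menus and measurability of the price. -/

variable {n : ℕ}

theorem continuous_utility : Continuous fun w : Outcome n × (Fin n → ℝ) => utility w.1 w.2 := by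
  unfold utility
  fun_prop

theorem tendsto_utility {e : ℕ → Outcome n} {v : ℕ → Fin n → ℝ} {f : Outcome n}
    {w : Fin n → ℝ} (he : Tendsto e atTop (𝓝 f)) (hv : Tendsto v atTop (𝓝 w)) :
    Tendsto (fun k => utility (e k) (v k)) atTop (𝓝 (utility f w)) := by
  have he1 : Tendsto (fun k => (e k).1) atTop (𝓝 f.1) := (continuous_fst.tendsto f).comp he
  have he2 : Tendsto (fun k => (e k).2) atTop (𝓝 f.2) := (continuous_snd.tendsto f).comp he
  unfold utility
  exact (tendsto_finsetSum _ fun i _ =>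
    (tendsto_pi_nhds.1 he1 i).mul (tendsto_pi_nhds.1 hv i)).sub he2

@[simp]
theorem utility_zero (v : Fin n → ℝ) : utility (0 : Outcome n) v = 0 := by
  simp [utility]

theorem isClosed_outcomes : IsClosed (outcomes n) := by
  have h : outcomes n = (⋂ i, {e : Outcome n | 0 ≤ e.1 i} ∩ {e | e.1 i ≤ 1}) ∩ {e | 0 ≤ e.2} := by
    ext e
    simp [outcomes]
  rw [h]
  refine (isClosed_iInter fun i => ?_).inter (isClosed_le (by fun_prop) (by fun_prop))
  exact (isClosed_le (by fun_prop) (by fun_prop)).inter (isClosed_le (by fun_prop) (by fun_prop))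

theorem isCompact_outcomes_inter (B : ℝ) : IsCompact (outcomes n ∩ {e | e.2 ≤ B}) := by
  have hK : IsCompact ((Icc (0 : Fin n → ℝ) 1) ×ˢ (Icc (0 : ℝ) B)) :=
    isCompact_Icc.prod isCompact_Icc
  refine hK.of_isClosed_subset
    (isClosed_outcomes.inter (isClosed_le (by fun_prop) (by fun_prop))) ?_
  rintro e ⟨⟨h1, h2⟩, h3⟩
  exact ⟨⟨fun i => (h1 i).1, fun i => (h1 i).2⟩, h2, h3⟩

theorem favorites_subset_favorites_closure (M : Set (Outcome n)) (v : Fin n → ℝ) :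
    favorites M v ⊆ favorites (closure M) v := by
  rintro e ⟨he, h⟩
  refine ⟨subset_closure he, fun f hf => ?_⟩
  have hcl : IsClosed {f : Outcome n | utility f v ≤ utility e v} :=
    isClosed_le (continuous_utility.comp (by fun_prop : Continuous fun f => (f, v)))
      continuous_const
  exact closure_minimal h hcl hf

theorem IsAuction.closure {M : Set (Outcome n)} (hM : IsAuction M) : IsAuction (closure M) :=
  ⟨closure_minimal hM.1 isClosed_outcomes, subset_closure hM.2.1, fun v hv =>
    (hM.2.2 v hv).mono (favorites_subset_favorites_closure M v)⟩

theorem revOf_le_revOf_closure (M : Set (Outcome n)) (F : Measure (Fin n → ℝ)) :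
    revOf M F ≤ revOf (closure M) F :=
  lintegral_mono fun v => biSup_mono fun _ he => favorites_subset_favorites_closure M v he

theorem price_le_sum {M : Set (Outcome n)} (hM : IsAuction M) {v : Fin n → ℝ}
    (hv : ∀ i, 0 ≤ v i) {e : Outcome n} (he : e ∈ favorites M v) : e.2 ≤ ∑ i, v i := by
  have h := he.2 0 hM.2.1
  rw [utility_zero, utility] at h
  have : ∑ i, e.1 i * v i ≤ ∑ i, v i := Finset.sum_le_sum fun i _ =>
    mul_le_of_le_one_left (hv i) ((hM.1 he.1).1 i).2
  linarith

/-- Along a convergent sequence of types the prices stay bounded by individual rationality, so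
favorites subconverge, and the limit is a favorite of the limit type. This yields measurability of
the maximal price. -/
theorem isClosed_superlevel {M : Set (Outcome n)} (hM : IsAuction M) (hc : IsClosed M) (a : ℝ) :
    IsClosed {v : Fin n → ℝ | (∀ i, 0 ≤ v i) ∧ ∃ e ∈ favorites M v, a ≤ e.2} := by
  apply IsSeqClosed.isClosed
  intro v w hv hvw
  rw [mem_ofPred_eq]
  replace hv : ∀ k, (∀ i, 0 ≤ v k i) ∧ ∃ e ∈ favorites M (v k), a ≤ e.2 := hv
  have hw : ∀ i, 0 ≤ w i := fun i =>
    ge_of_tendsto' ((tendsto_pi_nhds.1 hvw) i) fun k => (hv k).1 i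
  refine ⟨hw, ?_⟩
  choose e he hea using fun k => (hv k).2
  have hsum : Tendsto (fun k => ∑ i, v k i) atTop (𝓝 (∑ i, w i)) :=
    tendsto_finsetSum _ fun i _ => (tendsto_pi_nhds.1 hvw) i
  obtain ⟨B, hB⟩ := hsum.bddAbove_range
  have hmem : ∀ k, e k ∈ outcomes n ∩ {e | e.2 ≤ B} := fun k =>
    ⟨hM.1 (he k).1, (price_le_sum hM (hv k).1 (he k)).trans (hB (mem_range_self k))⟩
  obtain ⟨f, -, φ, hφ, hf⟩ := (isCompact_outcomes_inter B).tendsto_subseq hmem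
  have hvφ := hvw.comp hφ.tendsto_atTop
  refine ⟨f, ⟨hc.mem_of_tendsto hf (Eventually.of_forall fun k => (he (φ k)).1),
    fun g hg => ?_⟩, ?_⟩
  swap
  · have hf2 : Tendsto (fun k => (e (φ k)).2) atTop (𝓝 f.2) :=
      (continuous_snd.tendsto f).comp hf
    exact ge_of_tendsto' hf2 fun k => hea (φ k)
  have h1 : Tendsto (fun k => utility g (v (φ k))) atTop (𝓝 (utility g w)) :=
    tendsto_utility tendsto_const_nhds hvφ
  have h2 : Tendsto (fun k => utility (e (φ k)) (v (φ k))) atTop (𝓝 (utility f w)) :=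
    tendsto_utility hf hvφ
  exact le_of_tendsto_of_tendsto' h1 h2 fun k => (he (φ k)).2 g hg

theorem exists_favorite_max_price {M : Set (Outcome n)} (hM : IsAuction M) (hc : IsClosed M)
    {v : Fin n → ℝ} (hv : ∀ i, 0 ≤ v i) :
    ∃ e ∈ favorites M v, ∀ f ∈ favorites M v, f.2 ≤ e.2 := by
  have hcl : IsClosed (favorites M v) := by
    have : favorites M v = M ∩ ⋂ f ∈ M, {e | utility f v ≤ utility e v} := by
      ext e
      simp [favorites]
    rw [this]
    exact hc.inter (isClosed_biInter fun f _ => isClosed_le continuous_const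
      (continuous_utility.comp (by fun_prop : Continuous fun f => (f, v))))
  have hK : IsCompact (favorites M v) :=
    (isCompact_outcomes_inter (∑ i, v i)).of_isClosed_subset hcl fun e he =>
      ⟨hM.1 he.1, price_le_sum hM hv he⟩
  obtain ⟨e, he, hmax⟩ := hK.exists_isMaxOn (hM.2.2 v hv) continuous_snd.continuousOn
  exact ⟨e, he, fun f hf => hmax hf⟩

/-- A closed auction has a selection of most expensive favorites with measurable price. -/
theorem exists_measurable_selection {M : Set (Outcome n)} (hM : IsAuction M) (hc : IsClosed M) :
    ∃ e : (Fin n → ℝ) → Outcome n, Measurable (fun v => (e v).2) ∧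
      ∀ v, (∀ i, 0 ≤ v i) → e v ∈ favorites M v ∧ payment M v = ENNReal.ofReal (e v).2 := by
  classical
  have hex : ∀ v : Fin n → ℝ, ∃ e : Outcome n, ((∀ i, 0 ≤ v i) →
      e ∈ favorites M v ∧ ∀ f ∈ favorites M v, f.2 ≤ e.2) ∧ (¬ (∀ i, 0 ≤ v i) → e = 0) := by
    intro v
    by_cases hv : ∀ i, 0 ≤ v i
    · obtain ⟨e, he⟩ := exists_favorite_max_price hM hc hv
      exact ⟨e, fun _ => he, fun h => absurd hv h⟩
    · exact ⟨0, fun h => absurd h hv, fun _ => rfl⟩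
  choose e he he0 using hex
  refine ⟨e, measurable_of_Ici fun a => ?_, fun v hv => ⟨(he v hv).1, le_antisymm ?_ ?_⟩⟩
  · have hpos : MeasurableSet {v : Fin n → ℝ | ∀ i, 0 ≤ v i} := by
      have : {v : Fin n → ℝ | ∀ i, 0 ≤ v i} = Ici 0 := rfl
      rw [this]
      exact isClosed_Ici.measurableSet
    have hset : (fun v => (e v).2) ⁻¹' Ici a =
        {v : Fin n → ℝ | (∀ i, 0 ≤ v i) ∧ ∃ e ∈ favorites M v, a ≤ e.2} ∪
          ({v : Fin n → ℝ | ∀ i, 0 ≤ v i}ᶜ ∩ {_v | a ≤ 0}) := by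
      ext v
      by_cases hv : ∀ i, 0 ≤ v i
      · simp only [mem_preimage, mem_Ici, mem_union, mem_ofPred_eq, mem_inter_iff, mem_compl_iff,
          hv, implies_true, true_and, not_true_eq_false, false_and, or_false]
        exact ⟨fun h => ⟨e v, (he v hv).1, h⟩, fun ⟨f, hf, h⟩ => h.trans ((he v hv).2 f hf)⟩
      · simp [hv, he0 v hv]
    rw [hset]
    exact (isClosed_superlevel hM hc a).measurableSet.union
      (hpos.compl.inter (MeasurableSet.const _))
  · exact iSup₂_le fun f hf => ENNReal.ofReal_le_ofReal ((he v hv).2 f hf)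
  · exact le_iSup₂ (f := fun (f : Outcome n) (_ : f ∈ favorites M v) => ENNReal.ofReal f.2)
      (e v) (he v hv).1

/-! ### Finite menus and the case of one item. -/

theorem isAuction_of_finite {M : Set (Outcome n)} (hM : M ⊆ outcomes n) (h0 : (0 : Outcome n) ∈ M)
    (hfin : M.Finite) : IsAuction M :=
  ⟨hM, h0, fun v _ => (exists_max_image M (fun e => utility e v) hfin ⟨0, h0⟩).imp
    fun _ he => ⟨he.1, he.2⟩⟩

theorem revOf_le_RevC {M : Set (Outcome n)} (hM : IsAuction M) {C : ℕ} (hC : menuSize M ≤ C)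
    (F : Measure (Fin n → ℝ)) : revOf M F ≤ RevC C F :=
  le_iSup_of_le M (le_iSup_of_le hM (le_iSup_of_le hC le_rfl))

theorem ofReal_price_le_payment {M : Set (Outcome n)} {v : Fin n → ℝ} {e : Outcome n}
    (he : e ∈ favorites M v) : ENNReal.ofReal e.2 ≤ payment M v :=
  le_iSup₂ (f := fun (f : Outcome n) (_ : f ∈ favorites M v) => ENNReal.ofReal f.2) e he

/-- The outcome that allocates exactly item `i`, for the price `p`. -/
def bundle (i : Fin n) (p : ℝ) : Outcome n := (Pi.single i 1, p)

theorem utility_bundle (i : Fin n) (p : ℝ) (v : Fin n → ℝ) :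
    utility (bundle i p) v = v i - p := by
  simp [utility, bundle, Pi.single_apply]

theorem bundle_mem_outcomes (i : Fin n) {p : ℝ} (hp : 0 ≤ p) : bundle i p ∈ outcomes n := by
  refine ⟨fun j => ?_, hp⟩
  by_cases h : j = i <;> simp [bundle, h]

theorem measurableSet_nonneg : MeasurableSet {v : Fin n → ℝ | ∀ i, 0 ≤ v i} :=
  (isClosed_Ici : IsClosed (Ici (0 : Fin n → ℝ))).measurableSet

/-- Selling a single item by posting one price is almost optimal. -/
theorem Rev_le_RevC_one (F : Measure (Fin 1 → ℝ)) [IsProbabilityMeasure F]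
    (hF : ∀ᵐ v ∂F, ∀ i, 0 ≤ v i) {ε : ℝ} (hε0 : 0 < ε) (hε1 : ε < 1) :
    ENNReal.ofReal (1 - ε) * Rev F ≤ RevC 1 F + ENNReal.ofReal ε := by
  simp only [Rev, ENNReal.mul_iSup]
  refine iSup₂_le fun M hM => ?_
  obtain ⟨e, -, he⟩ := exists_measurable_selection hM.closure isClosed_closure
  have hAu := hM.closure
  -- The Myerson lemma needs a positive lower bound on the values; types below `ε` pay at most `ε`.
  set s : Set (Fin 1 → ℝ) := {v | (∀ i, 0 ≤ v i)} ∩ {v | ε ≤ v 0} with hs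
  have hsm : MeasurableSet s :=
    measurableSet_nonneg.inter (measurableSet_le measurable_const (measurable_pi_apply 0))
  have hout : ∀ v, (∀ i, 0 ≤ v i) → e v ∈ outcomes 1 := fun v hv => hAu.1 (he v hv).1.1
  have hr : 1 < 1 / (1 - ε) := by rw [lt_div_iff₀] <;> linarith
  have hmy := lintegral_le_of_approx_incentive_compatible F hsm (z := fun v => v 0)
    (y := fun v => (e v).1 0) (q := fun v => (e v).2) (measurable_pi_apply 0) le_rfl hr hε0
    (fun v hv => hv.2) (fun v hv => ((hout v hv.1).1 0).1) (fun v hv => ((hout v hv.1).1 0).2)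
    (fun v hv => (hout v hv.1).2)
    (fun v hv => by
      have := (he v hv.1).1.2 0 hAu.2.1
      simp [utility] at this
      linarith)
    (fun v hv w hw => by
      have := (he v hv.1).1.2 (e w) (he w hw.1).1.1
      simp [utility] at this
      linarith) (G := RevC 1 F) (fun t ht => by
        have ht0 : 0 ≤ t := hε0.le.trans ht
        have hA : IsAuction ({0, bundle 0 t} : Set (Outcome 1)) := by
          refine isAuction_of_finite ?_ (by simp) (by simp)
          rintro f (rfl | rfl)
          · exact ⟨fun i => by simp, by simp⟩
          · exact bundle_mem_outcomes 0 ht0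
        refine le_trans ?_ (revOf_le_RevC hA ?_ F)
        · have hm : MeasurableSet (s ∩ {v | t ≤ v 0}) :=
            hsm.inter (measurableSet_le measurable_const (measurable_pi_apply 0))
          rw [← lintegral_indicator_const hm]
          refine lintegral_mono fun v => indicator_le (fun v hv => ?_) v
          refine ofReal_price_le_payment (e := bundle 0 t) ⟨by simp, ?_⟩
          have := hv.2
          rintro f (rfl | rfl)
          · rw [utility_zero, utility_bundle]
            exact sub_nonneg.2 this
          · exact le_rfl
        · calc menuSize ({0, bundle 0 t} : Set (Outcome 1))
              ≤ ({bundle 0 t} : Set (Outcome 1)).encard := by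
                refine encard_le_encard ?_
                rintro f ⟨rfl | h, h'⟩
                · exact absurd rfl h'
                · exact h
            _ = ((1 : ℕ) : ℕ∞) := by simp)
  simp only [zero_mul, sub_zero] at hmy
  calc ENNReal.ofReal (1 - ε) * revOf M F
      ≤ ENNReal.ofReal (1 - ε) * revOf (closure M) F := by
        gcongr
        exact revOf_le_revOf_closure M F
    _ = ENNReal.ofReal (1 - ε) * ∫⁻ v, ENNReal.ofReal (e v).2 ∂F := by
        congr 1
        exact lintegral_congr_ae (hF.mono fun v hv => (he v hv).2)
    _ = ENNReal.ofReal (1 - ε) * ∫⁻ v in s, ENNReal.ofReal (e v).2 ∂F +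
          ENNReal.ofReal (1 - ε) * ∫⁻ v in sᶜ, ENNReal.ofReal (e v).2 ∂F := by
        rw [← mul_add, lintegral_add_compl _ hsm]
    _ ≤ ENNReal.ofReal (1 - ε) * (ENNReal.ofReal (1 / (1 - ε)) * RevC 1 F) +
          1 * ∫⁻ _v, ENNReal.ofReal ε ∂F := by
        refine add_le_add (mul_le_mul' le_rfl hmy)
          (mul_le_mul' (ENNReal.ofReal_le_one.2 (by linarith)) ?_)
        refine le_trans (lintegral_mono_ae ?_) (setLIntegral_le_lintegral sᶜ _)
        refine (ae_restrict_iff' hsm.compl).2 (hF.mono fun v hv hvs => ?_)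
        refine ENNReal.ofReal_le_ofReal ((price_le_sum hAu hv (he v hv).1).trans ?_)
        simp only [Finset.univ_unique, Finset.sum_singleton]
        by_contra hcon
        exact hvs ⟨hv, (not_le.1 hcon).le⟩
    _ = RevC 1 F + ENNReal.ofReal ε := by
        rw [← mul_assoc, ← ENNReal.ofReal_mul (by linarith),
          mul_one_div_cancel (by linarith : (1 - ε) ≠ 0)]
        simp

/-! ### Rounding the cheap part of a menu. -/

/-- Finitely many outcomes of a closed menu represent, up to rounding of the price and of all but
one coordinate, all outcomes of moderate price. -/
theorem exists_finite_representatives {M : Set (Outcome n)} (hM : M ⊆ outcomes n)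
    (hc : IsClosed M) {D : ℕ} (hD : 0 < D) {ρ p₀ : ℝ} (hρ : 1 < ρ) (hp₀ : 0 < p₀) (J : ℕ) :
    ∃ R ⊆ M, (∀ f ∈ R, f.2 ≤ p₀ * ρ ^ J) ∧ R.encard ≤ ((n * (D + 1) ^ n * J : ℕ) : ℕ∞) ∧
      ∀ i, ∀ e ∈ M, p₀ ≤ e.2 → e.2 < p₀ * ρ ^ J → ∃ f ∈ R, e.1 i ≤ f.1 i ∧
        (∀ j, j ≠ i → e.1 j - 1 / D ≤ f.1 j) ∧ e.2 ≤ ρ * f.2 ∧ f.2 ≤ ρ * e.2 := by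
  have hD' : (0 : ℝ) < D := Nat.cast_pos.2 hD
  -- Allocations are bounded only from below, which is all the buyer's utility needs. All
  -- inequalities are weak, so cells are compact and the exempt coordinate attains its maximum.
  let cell : Fin n × (Fin n → Fin (D + 1)) × Fin J → Set (Outcome n) := fun κ =>
    M ∩ ((⋂ j, {e | j ≠ κ.1 → ((κ.2.1 j : ℕ) : ℝ) / D ≤ e.1 j}) ∩
      ({e | p₀ * ρ ^ (κ.2.2 : ℕ) ≤ e.2} ∩ {e | e.2 ≤ p₀ * ρ ^ ((κ.2.2 : ℕ) + 1)}))
  have hcell : ∀ κ, IsCompact (cell κ) := by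
    intro κ
    refine (isCompact_outcomes_inter (p₀ * ρ ^ ((κ.2.2 : ℕ) + 1))).of_isClosed_subset ?_
      fun e he => ⟨hM he.1, he.2.2.2⟩
    refine hc.inter (IsClosed.inter (isClosed_iInter fun j => ?_) (IsClosed.inter ?_ ?_))
    · by_cases h : j = κ.1
      · simp [h]
      · simp only [ne_eq, h, not_false_eq_true, forall_true_left]
        exact isClosed_le (by fun_prop) (by fun_prop)
    · exact isClosed_le (by fun_prop) (by fun_prop)
    · exact isClosed_le (by fun_prop) (by fun_prop)
  have hrep : ∀ κ, ∃ f : Outcome n, (cell κ).Nonempty →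
      f ∈ cell κ ∧ ∀ e ∈ cell κ, e.1 κ.1 ≤ f.1 κ.1 := by
    intro κ
    by_cases h : (cell κ).Nonempty
    · obtain ⟨f, hf, hmax⟩ := (hcell κ).exists_isMaxOn h
        (f := fun e : Outcome n => e.1 κ.1) (by fun_prop)
      exact ⟨f, fun _ => ⟨hf, fun e he => hmax he⟩⟩
    · exact ⟨0, fun h' => absurd h' h⟩
  choose rep hrep using hrep
  refine ⟨rep '' {κ | (cell κ).Nonempty}, ?_, ?_, ?_, ?_⟩
  · rintro _ ⟨κ, hκ, rfl⟩
    exact (hrep κ hκ).1.1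
  · rintro _ ⟨κ, hκ, rfl⟩
    refine (hrep κ hκ).1.2.2.2.trans ?_
    have : ρ ^ ((κ.2.2 : ℕ) + 1) ≤ ρ ^ J := pow_le_pow_right₀ hρ.le κ.2.2.2
    gcongr
  · refine (encard_image_le _ _).trans ((encard_le_encard (subset_univ _)).trans ?_)
    rw [encard_univ]
    simp [mul_assoc]
  · intro i e he hp1 hp2
    obtain ⟨k, hk1, hk2⟩ := exists_nat_pow_near ((one_le_div hp₀).2 hp1) hρ
    rw [le_div_iff₀ hp₀, mul_comm] at hk1
    rw [div_lt_iff₀ hp₀, mul_comm] at hk2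
    have hkJ : k < J := by
      have : p₀ * ρ ^ k < p₀ * ρ ^ J := hk1.trans_lt hp2
      exact (pow_lt_pow_iff_right₀ hρ).1 (lt_of_mul_lt_mul_left this hp₀.le)
    have hfl : ∀ j, ⌊(D : ℝ) * e.1 j⌋₊ < D + 1 := fun j => by
      refine Nat.lt_succ_of_le (Nat.floor_le_of_le ?_)
      exact mul_le_of_le_one_right hD'.le ((hM he).1 j).2
    set κ : Fin n × (Fin n → Fin (D + 1)) × Fin J :=
      (i, fun j => ⟨⌊(D : ℝ) * e.1 j⌋₊, hfl j⟩, ⟨k, hkJ⟩) with hκ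
    have hmem : e ∈ cell κ := by
      refine ⟨he, mem_iInter.2 fun j _ => ?_, hk1, hk2.le⟩
      rw [div_le_iff₀ hD', mul_comm (e.1 j)]
      exact Nat.floor_le (mul_nonneg hD'.le ((hM he).1 j).1)
    obtain ⟨hf, hfmax⟩ := hrep κ ⟨e, hmem⟩
    refine ⟨rep κ, ⟨κ, ⟨e, hmem⟩, rfl⟩, hfmax e hmem, fun j hj => ?_, ?_, ?_⟩
    · refine le_trans ?_ (mem_iInter.1 hf.2.1 j hj)
      have h1 := (Nat.lt_floor_add_one ((D : ℝ) * e.1 j)).le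
      rw [sub_le_iff_le_add, ← add_div, le_div_iff₀ hD', mul_comm (e.1 j)]
      exact h1
    · have h1 : p₀ * ρ ^ k ≤ (rep κ).2 := hf.2.2.1
      have h2 : p₀ * ρ ^ (k + 1) = ρ * (p₀ * ρ ^ k) := by ring
      nlinarith
    · have h1 : (rep κ).2 ≤ p₀ * ρ ^ (k + 1) := hf.2.2.2
      have h2 : p₀ * ρ ^ (k + 1) = ρ * (p₀ * ρ ^ k) := by ring
      nlinarith

/-! ### Discounted menus. -/

/-- The menu that offers the outcomes in `R` and the null outcome with prices discounted by the
factor `1 - η`, together with each single item `i` for the price `P i`. -/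
def discountMenu (R : Set (Outcome n)) (η : ℝ) (P : Fin n → ℝ) : Set (Outcome n) :=
  (fun f => (f.1, (1 - η) * f.2)) '' insert 0 R ∪ range fun i => bundle i (P i)

theorem isAuction_discountMenu {R : Set (Outcome n)} (hR : R ⊆ outcomes n) (hfin : R.Finite)
    {η : ℝ} (hη : η ≤ 1) {P : Fin n → ℝ} (hP : ∀ i, 0 ≤ P i) :
    IsAuction (discountMenu R η P) := by
  refine isAuction_of_finite ?_ (Or.inl ⟨0, mem_insert _ _, by simp⟩)
    (((hfin.insert 0).image _).union (finite_range _))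
  rintro _ (⟨f, rfl | hf, rfl⟩ | ⟨i, rfl⟩)
  · exact ⟨fun i => by simp, by simp⟩
  · exact ⟨(hR hf).1, mul_nonneg (by linarith) (hR hf).2⟩
  · exact bundle_mem_outcomes i (hP i)

theorem menuSize_discountMenu_le (R : Set (Outcome n)) (η : ℝ) (P : Fin n → ℝ) :
    menuSize (discountMenu R η P) ≤ R.encard + n := by
  have hsub : discountMenu R η P \ {0} ⊆
      (fun f : Outcome n => ((f.1, (1 - η) * f.2) : Outcome n)) '' R ∪
        range fun i => bundle i (P i) := by
    rintro _ ⟨⟨f, rfl | hf, rfl⟩ | h, h0⟩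
    · exact absurd (by simp) h0
    · exact Or.inl ⟨f, hf, rfl⟩
    · exact Or.inr h
  refine (encard_le_encard hsub).trans ((encard_union_le _ _).trans ?_)
  refine add_le_add (encard_image_le _ _) ?_
  rw [← image_univ]
  refine (encard_image_le _ _).trans ?_
  simp [encard_univ]

theorem sum_mul_le {x v : Fin n → ℝ} (hx : ∀ j, 0 ≤ x j ∧ x j ≤ 1) (hv : ∀ j, 0 ≤ v j) {H : ℝ}
    (hH : 0 ≤ H) (i : Fin n) (hi : ∀ j, j ≠ i → v j ≤ H) :
    ∑ j, x j * v j ≤ x i * v i + n * H := by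
  calc ∑ j, x j * v j ≤ ∑ j, ((if j = i then x i * v i else 0) + H) := by
        refine Finset.sum_le_sum fun j _ => ?_
        split_ifs with h
        · subst h; linarith
        · have := mul_le_of_le_one_left (hv j) (hx j).2
          linarith [hi j h]
    _ = _ := by simp [Finset.sum_add_distrib]

theorem mul_le_sum_mul {x v : Fin n → ℝ} (hx : ∀ j, 0 ≤ x j ∧ x j ≤ 1) (hv : ∀ j, 0 ≤ v j)
    (i : Fin n) : x i * v i ≤ ∑ j, x j * v j :=
  Finset.single_le_sum (f := fun j => x j * v j)
    (fun j _ => mul_nonneg (hx j).1 (hv j)) (Finset.mem_univ i)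

/-- In the discounted menu, a type pays almost as much as for its favorite of moderate price. -/
theorem le_price_of_mem_favorites_discountMenu {M R : Set (Outcome n)} (hM : IsAuction M)
    (hRM : R ⊆ M) {η ρ H : ℝ} {D : ℕ} {P : Fin n → ℝ} (hη0 : 0 < η) (hη1 : η < 1) (hH : 0 ≤ H)
    (hρ1 : 1 < ρ) (hρ : ρ - 1 ≤ η ^ 2) (hD : 0 < D) (hHD : n * H ≤ η ^ 2 * D)
    {v : Fin n → ℝ} (hv : ∀ j, 0 ≤ v j) {i : Fin n} (hi : ∀ j, j ≠ i → v j ≤ H)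
    {e : Outcome n} (he : e ∈ favorites M v) (heP : ∀ j, e.2 ≤ P j)
    (hrep : ∃ f ∈ R, e.1 i ≤ f.1 i ∧
        (∀ j, j ≠ i → e.1 j - 1 / D ≤ f.1 j) ∧ e.2 ≤ ρ * f.2 ∧ f.2 ≤ ρ * e.2)
    {g : Outcome n} (hg : g ∈ favorites (discountMenu R η P) v) :
    (1 - 3 * η) * e.2 - η ≤ g.2 := by
  have hD' : (0 : ℝ) < D := Nat.cast_pos.2 hD
  have he0 : 0 ≤ e.2 := (hM.1 he.1).2
  have hηe : 0 ≤ η * e.2 := mul_nonneg hη0.le he0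
  obtain ⟨f, hfR, hfi, hfj, hf1, hf2⟩ := hrep
  rcases hg.1 with ⟨g', hg', rfl⟩ | ⟨j, rfl⟩
  swap
  -- Switching to a single-item entry does no harm: its price is at least that of `e`.
  · have := heP j
    simp only [bundle]
    nlinarith
  have hg'M : g' ∈ M := by
    rcases hg' with rfl | h
    · exact hM.2.1
    · exact hRM h
  have hg0 : 0 ≤ g'.2 := (hM.1 hg'M).2
  have h1 : utility g' v ≤ utility e v := he.2 g' hg'M
  have h2 := hg.2 (f.1, (1 - η) * f.2) (Or.inl ⟨f, mem_insert_of_mem _ hfR, rfl⟩)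
  have h3 : ∑ j, e.1 j * v j ≤ ∑ j, f.1 j * v j + η ^ 2 := by
    calc ∑ j, e.1 j * v j ≤ ∑ j, (f.1 j * v j + H / D) := by
          refine Finset.sum_le_sum fun j _ => ?_
          have hHD0 : 0 ≤ H / D := div_nonneg hH hD'.le
          by_cases h : j = i
          · subst h
            linarith [mul_le_mul_of_nonneg_right hfi (hv j)]
          · have h4 := mul_le_mul_of_nonneg_right (hfj j h) (hv j)
            have h5 : 1 / (D : ℝ) * v j ≤ H / D := by
              rw [one_div_mul_eq_div]
              exact div_le_div_of_nonneg_right (hi j h) hD'.le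
            linarith
      _ = ∑ j, f.1 j * v j + n * H / D := by
          simp [Finset.sum_add_distrib, mul_div_assoc]
      _ ≤ _ := by
          gcongr
          rw [div_le_iff₀ hD']
          exact hHD
  simp only [utility] at h1 h2 ⊢
  have hη2 : η ^ 2 * e.2 = η * (η * e.2) := by ring
  have h4 : f.2 ≤ e.2 + η ^ 2 * e.2 := by nlinarith
  have h5 : e.2 - η ^ 2 * e.2 ≤ f.2 := by
    have : (2 - ρ) * e.2 ≤ (2 - ρ) * (ρ * f.2) :=
      mul_le_mul_of_nonneg_left hf1 (by nlinarith)
    have hf0 : 0 ≤ f.2 := (hM.1 (hRM hfR)).2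
    have h6 : (2 - ρ) * (ρ * f.2) ≤ f.2 := by nlinarith [mul_nonneg hf0 (sq_nonneg (ρ - 1))]
    nlinarith
  -- Revealed preference: `e` beats `g'` at full prices and `g'` beats `f` at discounted ones, while
  -- `f` is within η² * (1 + e.2) of `e` in utility. Only the discounts remain, and dividing by `η`
  -- leaves an error of order `η`.
  have h6 : η * (f.2 - η - η * e.2) ≤ η * g'.2 := by nlinarith
  have h7 : f.2 - η - η * e.2 ≤ g'.2 := le_of_mul_le_mul_left h6 hη0
  have h8 : (1 - η) * (e.2 - η ^ 2 * e.2 - η - η * e.2) ≤ (1 - η) * g'.2 :=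
    mul_le_mul_of_nonneg_left (by linarith) (by linarith)
  nlinarith [mul_nonneg hηe (sq_nonneg η), sq_nonneg η]

/-- Entries from `R` are worth at most s * v i + n * H to such a type, even if free, and the other
single items cost at least their value. The condition involves no price but `P i`, so the prices can
be optimized separately. -/
theorem bundle_mem_favorites_discountMenu {M R : Set (Outcome n)} (hM : IsAuction M)
    (hRM : R ⊆ M) {η H : ℝ} {P : Fin n → ℝ} (hη1 : η ≤ 1) (hH : 0 ≤ H)
    {v : Fin n → ℝ} (hv : ∀ j, 0 ≤ v j) {i : Fin n} (hi : ∀ j, j ≠ i → v j ≤ H)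
    (hP : ∀ j, H ≤ P j) {s : ℝ} (hs0 : 0 ≤ s) (hs : ∀ f ∈ R, f.1 i ≤ s)
    (hvi : P i + n * H ≤ (1 - s) * v i) :
    bundle i (P i) ∈ favorites (discountMenu R η P) v := by
  refine ⟨Or.inr ⟨i, rfl⟩, ?_⟩
  have h0 : s * v i + n * H ≤ v i - P i := by linarith
  have hsv : 0 ≤ s * v i := mul_nonneg hs0 (hv i)
  have hn : 0 ≤ n * H := by positivity
  rintro _ (⟨f, rfl | hf, rfl⟩ | ⟨j, rfl⟩) <;> rw [utility_bundle]
  · simp [utility]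
    linarith
  · have h1 := sum_mul_le (hM.1 (hRM hf)).1 hv hH i hi
    have h2 := mul_le_mul_of_nonneg_right (hs f hf) (hv i)
    have h3 : 0 ≤ (1 - η) * f.2 := mul_nonneg (by linarith) (hM.1 (hRM hf)).2
    simp only [utility]
    linarith
  · rw [utility_bundle]
    by_cases h : j = i
    · rw [h]
    · linarith [hP j, hi j h]

/-! ### Types with one large value. -/

/-- The nonnegative types whose only coordinate greater than `H` is the `i`-th one. -/
def unboundedAt (H : ℝ) (i : Fin n) : Set (Fin n → ℝ) :=
  {v | ∀ j, 0 ≤ v j} ∩ ({v | H < v i} ∩ ⋂ j, {v | j ≠ i → v j ≤ H})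

theorem mem_unboundedAt {H : ℝ} {i : Fin n} {v : Fin n → ℝ} :
    v ∈ unboundedAt H i ↔ (∀ j, 0 ≤ v j) ∧ H < v i ∧ ∀ j, j ≠ i → v j ≤ H := by
  simp [unboundedAt]

theorem measurableSet_unboundedAt (H : ℝ) (i : Fin n) : MeasurableSet (unboundedAt H i) := by
  refine measurableSet_nonneg.inter ((measurableSet_lt measurable_const
    (measurable_pi_apply i)).inter (MeasurableSet.iInter fun j => ?_))
  by_cases h : j = i
  · simp [h]
  · simp only [ne_eq, h, not_false_eq_true, forall_true_left]
    exact measurableSet_le (measurable_pi_apply j) measurable_const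

theorem eq_of_mem_unboundedAt {H : ℝ} {i j : Fin n} {v : Fin n → ℝ} (hi : v ∈ unboundedAt H i)
    (hj : v ∈ unboundedAt H j) : i = j := by
  by_contra h
  exact absurd ((mem_unboundedAt.1 hj).2.2 i h) (not_le.2 (mem_unboundedAt.1 hi).2.1)

theorem exists_forall_ne_le {H : ℝ} (hn : 1 ≤ n) {v : Fin n → ℝ}
    (hv : v ∈ exclusivelyUnbounded n H) :
    ∃ i : Fin n, (∀ j, j ≠ i → v j ≤ H) ∧ ((∃ j, H < v j) → H < v i) := by
  by_cases h : ∃ j, H < v j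
  · obtain ⟨i, hi⟩ := h
    refine ⟨i, fun j hj => ?_, fun _ => hi⟩
    by_contra hcon
    exact hj (encard_le_one_iff.1 hv.2 j i (not_le.1 hcon) hi)
  · push Not at h
    exact ⟨⟨0, hn⟩, fun j _ => h j, fun ⟨j, hj⟩ => absurd hj (not_lt.2 (h j))⟩

theorem mem_unboundedAt_of_lt_price {M : Set (Outcome n)} (hM : IsAuction M) {H : ℝ}
    (hn : 1 ≤ n) {v : Fin n → ℝ} (hv : v ∈ exclusivelyUnbounded n H) {e : Outcome n}
    (he : e ∈ favorites M v) (hp : n * H < e.2) : ∃ i, v ∈ unboundedAt H i := by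
  obtain ⟨i, hi, hi'⟩ := exists_forall_ne_le hn hv
  refine ⟨i, mem_unboundedAt.2 ⟨hv.1, hi' ?_, hi⟩⟩
  by_contra hcon
  push Not at hcon
  have h1 : ∑ j, v j ≤ ∑ _j : Fin n, H := Finset.sum_le_sum fun j _ => hcon j
  have h2 := price_le_sum hM hv.1 he
  simp at h1
  linarith

/-- The suprema over prices need not be attained and may be infinite; independent choices let them
be taken one index at a time. -/
theorem add_sum_iSup_le {ι T : Type*} [Nonempty T] [DecidableEq ι] (s : Finset ι)
    (G : ι → T → ℝ≥0∞) (a R : ℝ≥0∞) (h : ∀ t : ι → T, a + ∑ i ∈ s, G i (t i) ≤ R) :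
    a + ∑ i ∈ s, ⨆ t, G i t ≤ R := by
  induction s using Finset.induction_on generalizing a with
  | empty => simpa using h fun _ => Classical.arbitrary T
  | insert i s hi ih =>
    rw [Finset.sum_insert hi, ← add_assoc, ENNReal.add_iSup, ENNReal.iSup_add]
    refine iSup_le fun τ => ih _ fun t => ?_
    have := h (Function.update t i τ)
    rw [Finset.sum_insert hi, Function.update_self, ← add_assoc] at this
    convert this using 3 with j hj
    rw [Function.update_of_ne (ne_of_mem_of_not_mem hj hi)]

/-! ### Expensive purchases reduced to one dimension. -/

/-- The types of high value for item `i` only that pay at least `E₁`, when type `v` buys `e v`. -/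
def expensiveAt (e : (Fin n → ℝ) → Outcome n) (H E₁ : ℝ) (i : Fin n) : Set (Fin n → ℝ) :=
  unboundedAt H i ∩ {v | E₁ ≤ (e v).2}

theorem measurableSet_expensiveAt {e : (Fin n → ℝ) → Outcome n}
    (hem : Measurable fun v => (e v).2) (H E₁ : ℝ) (i : Fin n) :
    MeasurableSet (expensiveAt e H E₁ i) :=
  (measurableSet_unboundedAt H i).inter (measurableSet_le measurable_const hem)

/-- The revenue from the types with a high value for item `i` that pay at least `E₁` is nearly
matched by a single price for item `i`, even for the types that could otherwise get the fraction
`s` of it. -/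
theorem lintegral_expensiveAt_le (F : Measure (Fin n → ℝ)) {M : Set (Outcome n)}
    (hM : IsAuction M) {e : (Fin n → ℝ) → Outcome n} (hem : Measurable fun v => (e v).2)
    (he : ∀ v, (∀ i, 0 ≤ v i) → e v ∈ favorites M v) {η H E E₁ : ℝ} (hη0 : 0 < η) (hη1 : η ≤ 1)
    (hH : 0 ≤ H) (hE : 0 < E) (hHE : n * H * (1 + η) ≤ η * E) (hE₁ : 4 * E ≤ η * E₁)
    (i : Fin n) {f : Outcome n} (hfM : f ∈ M) (hfE : f.2 ≤ E) :
    ∫⁻ v in expensiveAt e H E₁ i, ENNReal.ofReal ((1 - η) * (e v).2) ∂F ≤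
      ENNReal.ofReal ((1 + η) ^ 2) * ⨆ P : {P : ℝ // E₁ - 3 * E ≤ P}, ENNReal.ofReal P *
        F (expensiveAt e H E₁ i ∩ {v | (P : ℝ) + n * H ≤ (1 - f.1 i) * v i}) := by
  set X := expensiveAt e H E₁ i with hX
  have hXm : MeasurableSet X := measurableSet_expensiveAt hem H E₁ i
  set s := f.1 i with hs
  have hs0 : 0 ≤ s := ((hM.1 hfM).1 i).1
  have hs1 : s ≤ 1 := ((hM.1 hfM).1 i).2
  have hnH0 : 0 ≤ n * H := by positivity
  have hnH : n * H ≤ η * E := by nlinarith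
  have hηE : η * E ≤ E := by nlinarith
  have hE₁4 : 4 * E ≤ E₁ := by
    by_contra hcon
    push Not at hcon
    nlinarith
  have hXv : ∀ v ∈ X, ∀ j, 0 ≤ v j := fun v hv => (mem_unboundedAt.1 hv.1).1
  have hXp : ∀ v ∈ X, E₁ ≤ (e v).2 := fun v hv => hv.2
  have hx : ∀ v ∈ X, ∀ j, 0 ≤ (e v).1 j ∧ (e v).1 j ≤ 1 := fun v hv =>
    (hM.1 (he v (hXv v hv)).1).1
  have hup : ∀ v ∈ X, utility (e v) v ≤ (e v).1 i * v i + n * H - (e v).2 := fun v hv =>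
    sub_le_sub_right (sum_mul_le (hx v hv) (hXv v hv) hH i (mem_unboundedAt.1 hv.1).2.2) _
  have hlow : ∀ v ∈ X, ∀ g ∈ M, g.1 i * v i - g.2 ≤ utility (e v) v := fun v hv g hg =>
    (sub_le_sub_right (mul_le_sum_mul (hM.1 hg).1 (hXv v hv) i) _).trans
      ((he v (hXv v hv)).2 g hg)
  -- Comparison with buying `f`, which gives the share `s` for at most `E`: what is paid beyond that
  -- must be justified by the extra share of item `i`.
  have hIR : ∀ v ∈ X, (e v).2 - E - n * H ≤ ((e v).1 i - s) * v i := fun v hv => by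
    have h1 := hlow v hv f hfM
    have h2 := hup v hv
    rw [← hs] at h1
    linarith
  obtain hemp | ⟨v₀, hv₀⟩ := X.eq_empty_or_nonempty
  · simp [hemp]
  have hS : 0 < 1 - s := by
    by_contra hcon
    push Not at hcon
    have h1 := hIR v₀ hv₀
    have h2 := mul_nonpos_of_nonpos_of_nonneg
      (by linarith [(hx v₀ hv₀ i).2] : (e v₀).1 i - s ≤ 0) (hXv v₀ hv₀ i)
    linarith [hXp v₀ hv₀]
  have hsub : ∀ v ∈ X, 0 ≤ (e v).1 i - s := fun v hv => by
    by_contra hcon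
    push Not at hcon
    have h1 := hIR v hv
    have h2 := mul_nonpos_of_nonpos_of_nonneg hcon.le (hXv v hv i)
    linarith [hXp v hv]
  have hyz : ∀ a : ℝ, ∀ v : Fin n → ℝ, a / (1 - s) * ((1 - s) * v i) = a * v i := fun a v => by
    field_simp
  -- The good sold is the remaining share 1 - s. Other items contribute between 0 and n * H to any
  -- utility, so incentive compatibility holds up to n * H.
  have hmy := lintegral_le_of_approx_incentive_compatible F hXm (z := fun v => (1 - s) * v i)
    (y := fun v => ((e v).1 i - s) / (1 - s)) (q := fun v => (e v).2 - E - n * H)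
    ((measurable_pi_apply i).const_mul _) hnH0 (by linarith : 1 < 1 + η)
    (by linarith : 0 < E₁ - 2 * E)
    (fun v hv => by
      have h1 := hIR v hv
      have h2 := mul_le_mul_of_nonneg_right
        (by linarith [(hx v hv i).2] : (e v).1 i - s ≤ 1 - s) (hXv v hv i)
      linarith [hXp v hv])
    (fun v hv => div_nonneg (hsub v hv) hS.le)
    (fun v hv => (div_le_one hS).2 (by linarith [(hx v hv i).2]))
    (fun v hv => by linarith [hXp v hv])
    (fun v hv => by
      rw [hyz]
      exact hIR v hv)
    (fun v hv w hw => by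
      rw [hyz, hyz]
      have h1 := hlow v hv (e w) (he w (hXv w hw)).1
      have h2 := hup v hv
      linarith)
    (G := ENNReal.ofReal (1 + η) * ⨆ P : {P : ℝ // E₁ - 3 * E ≤ P}, ENNReal.ofReal P *
        F (X ∩ {v | (P : ℝ) + n * H ≤ (1 - s) * v i}))
    (fun t ht => by
      have hP : E₁ - 3 * E ≤ t - n * H := by linarith
      -- The actual price is lowered by n * H to compensate for the other items; this costs a second
      -- factor 1 + η.
      have ht' : t ≤ (1 + η) * (t - n * H) := by nlinarith
      calc ENNReal.ofReal t * F (X ∩ {v | t ≤ (1 - s) * v i})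
          ≤ ENNReal.ofReal ((1 + η) * (t - n * H)) * F (X ∩ {v | t ≤ (1 - s) * v i}) :=
            mul_le_mul' (ENNReal.ofReal_le_ofReal ht') le_rfl
        _ = ENNReal.ofReal (1 + η) * (ENNReal.ofReal (t - n * H) *
              F (X ∩ {v | t - n * H + n * H ≤ (1 - s) * v i})) := by
            rw [ENNReal.ofReal_mul (by linarith), mul_assoc, sub_add_cancel]
        _ ≤ _ := mul_le_mul' le_rfl (le_iSup (fun P : {P : ℝ // E₁ - 3 * E ≤ P} =>
            ENNReal.ofReal P * F (X ∩ {v | (P : ℝ) + n * H ≤ (1 - s) * v i}))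
              ⟨t - n * H, hP⟩))
  refine le_trans (setLIntegral_mono' hXm fun v hv => ENNReal.ofReal_le_ofReal ?_)
    (hmy.trans_eq ?_)
  -- The total subtracted is at most 3 * E, which is below η * E₁.
  · have h1 : n * H * ((1 + η) / (1 + η - 1)) ≤ E := by
      rw [add_sub_cancel_left, ← mul_div_assoc, div_le_iff₀ hη0]
      linarith
    have h2 := mul_le_mul_of_nonneg_left (hXp v hv) hη0.le
    linarith
  · rw [← mul_assoc, ← ENNReal.ofReal_mul (by linarith), sq]

/-- A lower bound for the revenue of a discounted menu. -/
theorem le_revOf_discountMenu (F : Measure (Fin n → ℝ)) {M R : Set (Outcome n)}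
    (hM : IsAuction M) (hRM : R ⊆ M) (hfin : R.Finite)
    {e : (Fin n → ℝ) → Outcome n} (hem : Measurable fun v => (e v).2)
    (he : ∀ v, (∀ i, 0 ≤ v i) → e v ∈ favorites M v) {η H E E₁ ρ : ℝ} {D : ℕ} (hη0 : 0 < η)
    (hη1 : η < 1) (hH : 0 ≤ H) (hρ1 : 1 < ρ) (hρ : ρ - 1 ≤ η ^ 2) (hD : 0 < D)
    (hHD : n * H ≤ η ^ 2 * D) (hn : 1 ≤ n) (hE₁ : E ≤ E₁)
    (hF : ∀ᵐ v ∂F, v ∈ exclusivelyUnbounded n H)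
    (hrep : ∀ i, ∀ e ∈ M, η ≤ e.2 → e.2 < E → ∃ f ∈ R, e.1 i ≤ f.1 i ∧
        (∀ j, j ≠ i → e.1 j - 1 / D ≤ f.1 j) ∧ e.2 ≤ ρ * f.2 ∧ f.2 ≤ ρ * e.2)
    {s P : Fin n → ℝ} (hs0 : ∀ i, 0 ≤ s i) (hs : ∀ i, ∀ f ∈ R, f.1 i ≤ s i)
    (hPE : ∀ i, E ≤ P i) (hPH : ∀ i, H ≤ P i) :
    ∫⁻ v in {v | (e v).2 < E}, ENNReal.ofReal ((1 - 3 * η) * (e v).2 - η) ∂F +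
        ∑ i, ENNReal.ofReal (P i) *
          F (expensiveAt e H E₁ i ∩ {v | P i + n * H ≤ (1 - s i) * v i}) ≤
      revOf (discountMenu R η P) F := by
  set A : Fin n → Set (Fin n → ℝ) := fun i =>
    expensiveAt e H E₁ i ∩ {v | P i + n * H ≤ (1 - s i) * v i} with hA
  have hAm : ∀ i, MeasurableSet (A i) := fun i => (measurableSet_expensiveAt hem H E₁ i).inter
    (measurableSet_le measurable_const ((measurable_pi_apply i).const_mul _))
  have hLm : MeasurableSet {v | (e v).2 < E} := measurableSet_lt hem measurable_const
  have hAuc : IsAuction (discountMenu R η P) :=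
    isAuction_discountMenu (hRM.trans hM.1) hfin hη1.le fun i => hH.trans (hPH i)
  have hsum : ∑ i, ENNReal.ofReal (P i) * F (A i) =
      ∫⁻ v, ∑ i, (A i).indicator (fun _ => ENNReal.ofReal (P i)) v ∂F := by
    rw [lintegral_finsetSum _ fun i _ => measurable_const.indicator (hAm i)]
    exact Finset.sum_congr rfl fun i _ => (lintegral_indicator_const (hAm i) _).symm
  rw [hsum, ← lintegral_indicator hLm, ← lintegral_add_left
    ((((hem.const_mul _).sub_const _).ennreal_ofReal).indicator hLm)]
  refine lintegral_mono_ae (hF.mono fun v hv => ?_)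
  by_cases hvE : (e v).2 < E
  · have hz : ∀ i, (A i).indicator (fun _ => ENNReal.ofReal (P i)) v = 0 := fun i =>
      indicator_of_notMem (fun h => absurd (h.1.2 : E₁ ≤ (e v).2) (by linarith)) _
    rw [indicator_of_mem (show v ∈ {v | (e v).2 < E} from hvE), Finset.sum_eq_zero fun i _ => hz i,
      add_zero]
    by_cases hvη : η ≤ (e v).2
    · obtain ⟨g, hg⟩ := hAuc.2.2 v hv.1
      obtain ⟨i, hi, -⟩ := exists_forall_ne_le hn hv
      refine le_trans (ENNReal.ofReal_le_ofReal ?_) (ofReal_price_le_payment hg)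
      exact le_price_of_mem_favorites_discountMenu hM hRM hη0 hη1 hH hρ1 hρ hD hHD hv.1 hi
        (he v hv.1) (fun j => hvE.le.trans (hPE j))
        (hrep i _ (he v hv.1).1 hvη hvE) hg
    -- Prices below `η`, which have no representative, are absorbed by the subtracted `η`.
    · have h0 : 0 ≤ (e v).2 := (hM.1 (he v hv.1).1).2
      rw [ENNReal.ofReal_of_nonpos (by nlinarith)]
      exact zero_le
  · rw [indicator_of_notMem (show v ∉ {v | (e v).2 < E} from hvE), zero_add]
    by_cases hex : ∃ i, v ∈ A i
    · obtain ⟨i, hi⟩ := hex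
      rw [Finset.sum_eq_single i (fun j _ hj => indicator_of_notMem
        (fun h => hj (eq_of_mem_unboundedAt h.1.1 hi.1.1)) _) (by simp), indicator_of_mem hi]
      exact ofReal_price_le_payment (bundle_mem_favorites_discountMenu hM hRM hη1.le hH hv.1
        (mem_unboundedAt.1 hi.1.1).2.2 hPH (hs0 i) (hs i) hi.2)
    · push Not at hex
      rw [Finset.sum_eq_zero fun i _ => indicator_of_notMem (hex i) _]
      exact zero_le

/-- A menu of bounded size extracts most of the revenue that a closed menu gets from the types
that pay less than `η * ρ ^ J` and from those that pay at least `E₁`. -/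
theorem lintegral_low_add_high_le (F : Measure (Fin n → ℝ)) [IsProbabilityMeasure F]
    {M : Set (Outcome n)} (hM : IsAuction M) (hc : IsClosed M)
    {e : (Fin n → ℝ) → Outcome n} (hem : Measurable fun v => (e v).2)
    (he : ∀ v, (∀ i, 0 ≤ v i) → e v ∈ favorites M v) {η H E E₁ ρ : ℝ} {D J : ℕ} (hη0 : 0 < η)
    (hη1 : 3 * η < 1) (hH : 0 ≤ H) (hρ1 : 1 < ρ) (hρ : ρ - 1 ≤ η ^ 2) (hD : 0 < D)
    (hHD : n * H ≤ η ^ 2 * D) (hn : 1 ≤ n) (hE : E = η * ρ ^ J)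
    (hHE : n * H * (1 + η) ≤ η * E) (hE₁ : 4 * E ≤ η * E₁)
    (hF : ∀ᵐ v ∂F, v ∈ exclusivelyUnbounded n H) {C : ℕ} (hC : n * (D + 1) ^ n * J + n ≤ C) :
    ENNReal.ofReal (1 - 3 * η) * (∫⁻ v in {v | (e v).2 < E}, ENNReal.ofReal (e v).2 ∂F +
        ∫⁻ v in {v | E₁ ≤ (e v).2}, ENNReal.ofReal (e v).2 ∂F) ≤
      RevC C F + ENNReal.ofReal η := by
  have hE0 : 0 < E := by rw [hE]; positivity
  have hηE : η * E ≤ E := by nlinarith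
  have hE₁4 : 4 * E ≤ E₁ := by
    by_contra hcon
    push Not at hcon
    nlinarith
  have hn' : (1 : ℝ) ≤ n := by exact_mod_cast hn
  have hnH0 : 0 ≤ n * H := by positivity
  have hnHE : n * H ≤ E := by nlinarith
  have hHnH : H ≤ n * H := by nlinarith
  obtain ⟨R, hRM, hRE, hRcard, hrep⟩ := exists_finite_representatives hM.1 hc hD hρ1 hη0 J
  rw [← hE] at hRE hrep
  have hfin : R.Finite := finite_of_encard_le_coe hRcard
  -- The shares `s i` are fixed by the rounded menu before the prices `P i` are chosen; inserting 0
  -- covers empty `R`.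
  have hmax : ∀ i, ∃ f ∈ insert 0 R, ∀ g ∈ insert 0 R, g.1 i ≤ f.1 i := fun i =>
    exists_max_image _ (fun f : Outcome n => f.1 i) (hfin.insert 0) ⟨0, mem_insert _ _⟩
  choose f hf hfmax using hmax
  have hfM : ∀ i, f i ∈ M := fun i => by
    rcases hf i with h | h
    · rw [h]; exact hM.2.1
    · exact hRM h
  have hfE : ∀ i, (f i).2 ≤ E := fun i => by
    rcases hf i with h | h
    · rw [h]; exact hE0.le
    · exact hRE _ h
  set Low := ∫⁻ v in {v | (e v).2 < E}, ENNReal.ofReal ((1 - 3 * η) * (e v).2 - η) ∂F with hLow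
  set G : Fin n → {P : ℝ // E₁ - 3 * E ≤ P} → ℝ≥0∞ := fun i P => ENNReal.ofReal P *
        F (expensiveAt e H E₁ i ∩ {v | (P : ℝ) + n * H ≤ (1 - (f i).1 i) * v i}) with hG
  have : Nonempty {P : ℝ // E₁ - 3 * E ≤ P} := ⟨⟨_, le_rfl⟩⟩
  have hmain : Low + ∑ i, ⨆ P, G i P ≤ RevC C F := by
    refine add_sum_iSup_le _ _ _ _ fun P => ?_
    have hPE : ∀ i, E ≤ P i := fun i => by linarith [(P i).2]
    refine (le_revOf_discountMenu F hM hRM hfin hem he (P := fun i => P i) hη0 (by linarith) hH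
      hρ1 hρ hD hHD hn (by linarith) hF hrep (fun i => ((hM.1 (hfM i)).1 i).1)
      (fun i g hg => hfmax i g (mem_insert_of_mem _ hg)) hPE
      fun i => by linarith [hPE i]).trans (revOf_le_RevC (isAuction_discountMenu
        (hRM.trans hM.1) hfin (by linarith) fun i => hE0.le.trans (hPE i)) ?_ F)
    refine (menuSize_discountMenu_le _ _ _).trans ((add_le_add_left hRcard _).trans ?_)
    exact_mod_cast hC
  have hlow : ENNReal.ofReal (1 - 3 * η) * ∫⁻ v in {v | (e v).2 < E}, ENNReal.ofReal (e v).2 ∂F ≤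
      Low + ENNReal.ofReal η := by
    calc ENNReal.ofReal (1 - 3 * η) * ∫⁻ v in {v | (e v).2 < E}, ENNReal.ofReal (e v).2 ∂F
        = ∫⁻ v in {v | (e v).2 < E}, ENNReal.ofReal ((1 - 3 * η) * (e v).2) ∂F := by
          rw [← lintegral_const_mul _ hem.ennreal_ofReal]
          simp_rw [ENNReal.ofReal_mul (by linarith : 0 ≤ 1 - 3 * η)]
      _ ≤ ∫⁻ v in {v | (e v).2 < E}, (ENNReal.ofReal ((1 - 3 * η) * (e v).2 - η) +
            ENNReal.ofReal η) ∂F := by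
          refine lintegral_mono fun v => ?_
          refine le_trans (ENNReal.ofReal_le_ofReal ?_) ENNReal.ofReal_add_le
          linarith
      _ = Low + ∫⁻ v in {v | (e v).2 < E}, ENNReal.ofReal η ∂F :=
          lintegral_add_right _ measurable_const
      _ ≤ Low + ENNReal.ofReal η := by
          refine add_le_add le_rfl ((setLIntegral_le_lintegral _ _).trans ?_)
          simp
  have hhigh : ENNReal.ofReal (1 - 3 * η) *
      ∫⁻ v in {v | E₁ ≤ (e v).2}, ENNReal.ofReal (e v).2 ∂F ≤ ∑ i, ⨆ P, G i P := by
    have hcov : ∫⁻ v in {v | E₁ ≤ (e v).2}, ENNReal.ofReal (e v).2 ∂F ≤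
        ∑ i, ∫⁻ v in expensiveAt e H E₁ i, ENNReal.ofReal (e v).2 ∂F := by
      have hsum : ∑ i, ∫⁻ v in expensiveAt e H E₁ i, ENNReal.ofReal (e v).2 ∂F =
          ∫⁻ v, ∑ i, (expensiveAt e H E₁ i).indicator (fun v => ENNReal.ofReal (e v).2) v ∂F := by
        rw [lintegral_finsetSum _ fun i _ =>
          hem.ennreal_ofReal.indicator (measurableSet_expensiveAt hem H E₁ i)]
        exact Finset.sum_congr rfl fun i _ =>
          (lintegral_indicator (measurableSet_expensiveAt hem H E₁ i) _).symm
      rw [hsum, ← lintegral_indicator (measurableSet_le measurable_const hem)]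
      refine lintegral_mono_ae (hF.mono fun v hv => ?_)
      by_cases h : E₁ ≤ (e v).2
      · obtain ⟨i, hi⟩ := mem_unboundedAt_of_lt_price hM hn hv (he v hv.1) (by linarith)
        rw [indicator_of_mem (show v ∈ {v | E₁ ≤ (e v).2} from h),
          ← indicator_of_mem (show v ∈ expensiveAt e H E₁ i from ⟨hi, h⟩)
            (fun v => ENNReal.ofReal (e v).2)]
        exact Finset.single_le_sum (f := fun i => (expensiveAt e H E₁ i).indicator
          (fun v => ENNReal.ofReal (e v).2) v) (fun _ _ => zero_le) (Finset.mem_univ i)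
      · rw [indicator_of_notMem (show v ∉ {v | E₁ ≤ (e v).2} from h)]
        exact zero_le
    have hη2 : 0 < (1 + η) ^ 2 := by positivity
    have hκ : ENNReal.ofReal (1 - 3 * η) ≤
        ENNReal.ofReal (1 / (1 + η) ^ 2) * ENNReal.ofReal (1 - η) := by
      rw [← ENNReal.ofReal_mul (by positivity)]
      refine ENNReal.ofReal_le_ofReal ?_
      rw [one_div_mul_eq_div, le_div_iff₀ hη2]
      nlinarith [sq_nonneg η, mul_nonneg hη0.le (sq_nonneg η)]
    calc _ ≤ ENNReal.ofReal (1 - 3 * η) *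
            ∑ i, ∫⁻ v in expensiveAt e H E₁ i, ENNReal.ofReal (e v).2 ∂F :=
          mul_le_mul' le_rfl hcov
      _ = ∑ i, ENNReal.ofReal (1 - 3 * η) *
            ∫⁻ v in expensiveAt e H E₁ i, ENNReal.ofReal (e v).2 ∂F := Finset.mul_sum _ _ _
      _ ≤ ∑ i, ⨆ P, G i P := by
          refine Finset.sum_le_sum fun i _ => ?_
          have hi := lintegral_expensiveAt_le F hM hem he hη0 (by linarith) hH hE0 hHE hE₁ i
            (hfM i) (hfE i)
          simp_rw [ENNReal.ofReal_mul (by linarith : 0 ≤ 1 - η)] at hi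
          rw [lintegral_const_mul _ hem.ennreal_ofReal] at hi
          refine (mul_le_mul' hκ le_rfl).trans ?_
          rw [mul_assoc]
          refine (mul_le_mul' le_rfl hi).trans_eq ?_
          rw [← mul_assoc, ← ENNReal.ofReal_mul (by positivity), one_div_mul_cancel hη2.ne',
            ENNReal.ofReal_one, one_mul]
  rw [mul_add]
  calc _ ≤ Low + ENNReal.ofReal η + ∑ i, ⨆ P, G i P := add_le_add hlow hhigh
    _ = Low + ∑ i, (⨆ P, G i P) + ENNReal.ofReal η := by ring
    _ ≤ _ := add_le_add_left hmain _

/-! ### Choice of the discarded band and of the parameters. -/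

/-- Among `N` consecutive price bands there is one that contributes at most the fraction `1 / N`
of a total revenue. -/
theorem exists_band_le {X : Type*} [MeasurableSpace X] (μ : Measure X) {p : X → ℝ}
    (hp : Measurable p) {E : ℕ → ℝ} (hE : Monotone E) {N : ℕ} (hN : 0 < N) :
    ∃ k < N, ∫⁻ v in {v | E k ≤ p v ∧ p v < E (k + 1)}, ENNReal.ofReal (p v) ∂μ ≤
      ENNReal.ofReal (1 / N) * ∫⁻ v, ENNReal.ofReal (p v) ∂μ := by
  set B : ℕ → Set X := fun k => {v | E k ≤ p v ∧ p v < E (k + 1)} with hB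
  have hBm : ∀ k, MeasurableSet (B k) := fun k =>
    (measurableSet_le measurable_const hp).inter (measurableSet_lt hp measurable_const)
  have hdisj : ∀ j k, j < k → Disjoint (B j) (B k) := fun j k hjk => by
    refine disjoint_left.2 fun v hj hk => ?_
    have h1 : p v < E (j + 1) := hj.2
    have h2 : E k ≤ p v := hk.1
    linarith [hE (Nat.succ_le_of_lt hjk)]
  have hsum : ∑ k ∈ Finset.range N, ∫⁻ v in B k, ENNReal.ofReal (p v) ∂μ ≤
      ∫⁻ v, ENNReal.ofReal (p v) ∂μ := by
    rw [← lintegral_biUnion_finset (fun j _ k _ hjk => ?_) fun k _ => hBm k]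
    · exact setLIntegral_le_lintegral _ _
    · rcases lt_or_gt_of_ne hjk with h | h
      · exact hdisj j k h
      · exact (hdisj k j h).symm
  obtain ⟨k, hk, hmin⟩ := Finset.exists_min_image (Finset.range N)
    (fun k => ∫⁻ v in B k, ENNReal.ofReal (p v) ∂μ) ⟨0, Finset.mem_range.2 hN⟩
  refine ⟨k, Finset.mem_range.1 hk, ?_⟩
  have h1 := (Finset.card_nsmul_le_sum _ _ _ hmin).trans hsum
  rw [Finset.card_range, nsmul_eq_mul] at h1
  have hN' : (0 : ℝ) < N := Nat.cast_pos.2 hN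
  calc _ = ENNReal.ofReal (1 / N) * (N * ∫⁻ v in B k, ENNReal.ofReal (p v) ∂μ) := by
        rw [← mul_assoc, ← ENNReal.ofReal_natCast, ← ENNReal.ofReal_mul (by positivity),
          one_div_mul_cancel hN'.ne', ENNReal.ofReal_one, one_mul]
    _ ≤ _ := mul_le_mul' le_rfl h1

/-- The approximation guarantee in terms of the accuracy `1 / N`. -/
theorem Rev_le_RevC_of_natCast (F : Measure (Fin n → ℝ)) [IsProbabilityMeasure F] {H ε : ℝ}
    (hF : ∀ᵐ v ∂F, v ∈ exclusivelyUnbounded n H) (hn : 1 ≤ n) (hH : 0 ≤ H) {N C : ℕ}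
    (hN4 : 4 ≤ N) (hHN : n * H ≤ N) (hε : 8 / N ≤ ε) (hε1 : ε ≤ 1)
    (hC : n * (N ^ 3 + 1) ^ n * (N ^ 7 * N) + n ≤ C) :
    ENNReal.ofReal (1 - ε) * Rev F ≤ RevC C F + ENNReal.ofReal ε := by
  simp only [Rev, ENNReal.mul_iSup]
  refine iSup₂_le fun M₀ hM₀ => ?_
  refine le_trans (mul_le_mul' le_rfl (revOf_le_revOf_closure M₀ F)) ?_
  have hM := hM₀.closure
  have hc : IsClosed (closure M₀) := isClosed_closure
  generalize closure M₀ = M at hM hc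
  obtain ⟨e, hem, he⟩ := exists_measurable_selection hM hc
  have hX : revOf M F = ∫⁻ v, ENNReal.ofReal (e v).2 ∂F :=
    lintegral_congr_ae (hF.mono fun v hv => (he v hv.1).2)
  rw [hX]
  have hN : (4 : ℝ) ≤ N := by exact_mod_cast hN4
  have hN0 : (0 : ℝ) < N := by linarith
  set η : ℝ := 1 / N with hη
  have hη0 : 0 < η := by positivity
  have hηN : η * N = 1 := one_div_mul_cancel hN0.ne'
  have hη4 : 4 * η ≤ 1 := by nlinarith
  have hηε : 8 * η ≤ ε := by rw [hη, mul_one_div]; exact hε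
  set ρ : ℝ := 1 + η ^ 3 with hρ
  have hρ1 : 1 < ρ := by linarith [pow_pos hη0 3]
  -- Each band spans N ^ 7 grid steps of ratio 1 + η³. By Bernoulli its endpoints differ by a factor
  -- at least N ^ 4, and `N` bands use at most N ^ 8 price levels, whatever the size of the actual
  -- prices.
  set E : ℕ → ℝ := fun k => η * ρ ^ (N ^ 7 * (k + 1)) with hE
  have hA : (N : ℝ) ^ 4 ≤ ρ ^ N ^ 7 := by
    have h1 := one_add_mul_le_pow (by linarith [pow_pos hη0 3] : -2 ≤ η ^ 3) (N ^ 7)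
    have h2 : ((N ^ 7 : ℕ) : ℝ) * η ^ 3 = N ^ 4 := by
      push_cast
      calc (N : ℝ) ^ 7 * η ^ 3 = (N : ℝ) ^ 4 * (η * N) ^ 3 := by ring
        _ = (N : ℝ) ^ 4 := by rw [hηN]; ring
    rw [h2] at h1
    linarith
  have hEmono : Monotone E := fun j k hjk => by
    simp only [hE]
    have := pow_le_pow_right₀ hρ1.le (Nat.mul_le_mul_left (N ^ 7) (Nat.succ_le_succ hjk))
    gcongr
  have hE0 : ∀ k, (N : ℝ) ^ 3 ≤ E k := fun k => by
    refine le_trans ?_ (hEmono (Nat.zero_le k))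
    have h1 := mul_le_mul_of_nonneg_left hA hη0.le
    have h2 : η * (N : ℝ) ^ 4 = N ^ 3 := by
      calc η * (N : ℝ) ^ 4 = (η * N) * (N : ℝ) ^ 3 := by ring
        _ = (N : ℝ) ^ 3 := by rw [hηN, one_mul]
    simpa [hE, h2] using h1
  have hEs : ∀ k, 4 * E k ≤ η * E (k + 1) := fun k => by
    have h1 : E (k + 1) = ρ ^ N ^ 7 * E k := by simp only [hE]; ring
    have h2 : 0 ≤ E k := le_trans (by positivity) (hE0 k)
    have h3 : 4 ≤ η * ρ ^ N ^ 7 := by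
      calc (4 : ℝ) ≤ N := hN
        _ ≤ N ^ 3 := le_self_pow₀ (by linarith) (by norm_num)
        _ ≤ E 0 := hE0 0
        _ = _ := by simp [hE]
    rw [h1]
    exact (mul_le_mul_of_nonneg_right h3 h2).trans_eq (mul_assoc _ _ _)
  obtain ⟨k, hkN, hk⟩ := exists_band_le F hem hEmono (by omega : 0 < N)
  rw [← hη] at hk
  have hnH0 : 0 ≤ n * H := by positivity
  have hmain := lintegral_low_add_high_le F hM hc hem (fun v hv => (he v hv).1) (H := H) (E := E k) (E₁ := E (k + 1))
    (D := N ^ 3) (J := N ^ 7 * (k + 1)) (C := C) hη0 (by linarith) hH hρ1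
    (by
      rw [hρ, add_sub_cancel_left]
      exact pow_le_pow_of_le_one hη0.le (by linarith) (by norm_num)) (by positivity)
    (by
      have : η ^ 2 * ((N ^ 3 : ℕ) : ℝ) = N := by
        push_cast
        calc η ^ 2 * (N : ℝ) ^ 3 = (η * N) ^ 2 * (N : ℝ) := by ring
          _ = (N : ℝ) := by rw [hηN]; ring
      rw [this]
      exact hHN) hn rfl
    (by
      have h1 : η * (N : ℝ) ^ 3 ≤ η * E k := mul_le_mul_of_nonneg_left (hE0 k) hη0.le
      have h2 : η * (N : ℝ) ^ 3 = N ^ 2 := by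
        calc η * (N : ℝ) ^ 3 = (η * N) * (N : ℝ) ^ 2 := by ring
          _ = (N : ℝ) ^ 2 := by rw [hηN, one_mul]
      nlinarith) (hEs k) hF
    (by
      refine le_trans ?_ hC
      gcongr
      omega)
  set X := ∫⁻ v, ENNReal.ofReal (e v).2 ∂F with hXdef
  set Y := ∫⁻ v in {v | (e v).2 < E k}, ENNReal.ofReal (e v).2 ∂F +
        ∫⁻ v in {v | E (k + 1) ≤ (e v).2}, ENNReal.ofReal (e v).2 ∂F with hY
  set B := ∫⁻ v in {v | E k ≤ (e v).2 ∧ (e v).2 < E (k + 1)}, ENNReal.ofReal (e v).2 ∂F with hB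
  have hXY : X ≤ Y + B := by
    have hcov : (univ : Set (Fin n → ℝ)) ⊆ ({v | (e v).2 < E k} ∪ {v | E (k + 1) ≤ (e v).2}) ∪
        {v | E k ≤ (e v).2 ∧ (e v).2 < E (k + 1)} := fun v _ => by
      rcases lt_or_ge (e v).2 (E k) with h | h
      · exact Or.inl (Or.inl h)
      · rcases lt_or_ge (e v).2 (E (k + 1)) with h' | h'
        · exact Or.inr ⟨h, h'⟩
        · exact Or.inl (Or.inr h')
    rw [hXdef, ← setLIntegral_univ]
    refine (lintegral_mono_set hcov).trans ((lintegral_union_le _ _ _).trans ?_)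
    exact add_le_add (lintegral_union_le _ _ _) le_rfl
  -- Prices in the discarded band are bounded, so infinite revenue survives its removal.
  have hBfin : B ≠ ∞ := by
    refine ne_top_of_le_ne_top (b := ENNReal.ofReal (E (k + 1))) ENNReal.ofReal_ne_top ?_
    have hBm : MeasurableSet {v | E k ≤ (e v).2 ∧ (e v).2 < E (k + 1)} :=
      (measurableSet_le measurable_const hem).inter (measurableSet_lt hem measurable_const)
    refine (setLIntegral_mono' hBm fun v hv =>
      ENNReal.ofReal_le_ofReal hv.2.le).trans ((setLIntegral_le_lintegral _ _).trans ?_)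
    simp
  have hηX : ENNReal.ofReal (1 - η) * X ≤ Y := by
    by_cases hXtop : X = ∞
    · have : Y = ∞ := by
        by_contra hYtop
        rw [hXtop] at hXY
        exact absurd (top_le_iff.1 hXY) (ENNReal.add_ne_top.2 ⟨hYtop, hBfin⟩)
      rw [this]
      exact le_top
    · have h1 : ENNReal.ofReal (1 - η) * X + ENNReal.ofReal η * X ≤ Y + ENNReal.ofReal η * X := by
        rw [← add_mul, ← ENNReal.ofReal_add (by linarith) hη0.le, sub_add_cancel,
          ENNReal.ofReal_one, one_mul]
        exact hXY.trans (add_le_add le_rfl hk)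
      exact ENNReal.le_of_add_le_add_right (ENNReal.mul_ne_top ENNReal.ofReal_ne_top hXtop) h1
  calc ENNReal.ofReal (1 - ε) * X
      ≤ ENNReal.ofReal ((1 - 3 * η) * (1 - η)) * X := by
        refine mul_le_mul' (ENNReal.ofReal_le_ofReal ?_) le_rfl
        nlinarith [sq_nonneg η]
    _ = ENNReal.ofReal (1 - 3 * η) * (ENNReal.ofReal (1 - η) * X) := by
        rw [ENNReal.ofReal_mul (by linarith), mul_assoc]
    _ ≤ ENNReal.ofReal (1 - 3 * η) * Y := mul_le_mul' le_rfl hηX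
    _ ≤ RevC C F + ENNReal.ofReal η := hmain
    _ ≤ _ := add_le_add le_rfl (ENNReal.ofReal_le_ofReal (by linarith))

end MenuAuction

/-! ### The bound on the menu size. -/

theorem mainTheorem6 :
    ∃ K : ℕ, ∀ (n : ℕ) (H ε : ℝ), 1 ≤ n → 0 ≤ H → 0 < ε →
      ∃ C : ℕ, (C : ℝ) ≤ ((n : ℝ) * max 1 H / ε) ^ (K * n) ∧
        ∀ F : MeasureTheory.Measure (Fin n → ℝ), MeasureTheory.IsProbabilityMeasure F →
          (∀ᵐ v ∂F, v ∈ MenuAuction.exclusivelyUnbounded n H) →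
            ENNReal.ofReal (1 - ε) * MenuAuction.Rev F ≤
              MenuAuction.RevC C F + ENNReal.ofReal ε := by
  -- 70 = 5 * 14: the menu size is at most N ^ (14 * n), and N ≤ B ^ 5.
  refine ⟨70, fun n H ε hn hH hε => ?_⟩
  have hn' : (1 : ℝ) ≤ n := by exact_mod_cast hn
  have hmax : 1 ≤ max 1 H := le_max_left _ _
  have hnum : (n : ℝ) ≤ n * max 1 H := by nlinarith
  rcases le_or_gt 1 ε with hε1 | hε1
  · refine ⟨0, by push_cast; positivity, fun F _ _ => ?_⟩
    rw [ENNReal.ofReal_of_nonpos (by linarith), zero_mul]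
    exact zero_le
  set B : ℝ := n * max 1 H / ε with hB
  have hnB : (n : ℝ) ≤ B := by
    rw [hB, le_div_iff₀ hε]
    nlinarith
  -- For n = 1 the base `B` may be close to 1, so no power of it absorbs constants and a single
  -- entry must do. For n ≥ 2, B ≥ 2.
  obtain rfl | hn2 := hn.eq_or_lt
  · refine ⟨1, ?_, fun F _ hF => MenuAuction.Rev_le_RevC_one F (hF.mono fun v hv => hv.1) hε hε1⟩
    push_cast at hnB ⊢
    exact one_le_pow₀ hnB
  have hB2 : 2 ≤ B := le_trans (by exact_mod_cast hn2) hnB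
  set N : ℕ := ⌈8 * B⌉₊ with hN
  have hNB : 8 * B ≤ N := Nat.le_ceil _
  have hN16 : (16 : ℝ) ≤ N := by linarith
  have hN16' : 16 ≤ N := by exact_mod_cast hN16
  have hNB5 : (N : ℝ) ≤ B ^ 5 := by
    have h1 : (N : ℝ) < 8 * B + 1 := Nat.ceil_lt_add_one (by linarith)
    have h2 : (2 : ℝ) ^ 4 ≤ B ^ 4 := pow_le_pow_left₀ (by norm_num) hB2 4
    have h3 : B ^ 5 = B ^ 4 * B := by ring
    nlinarith
  have hBε : B * ε = n * max 1 H := div_mul_cancel₀ _ hε.ne'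
  have hHB : n * H ≤ N := by
    have h1 : n * H ≤ n * max 1 H := by gcongr; exact le_max_right _ _
    have h2 : B * ε ≤ B := mul_le_of_le_one_right (by linarith) hε1.le
    linarith
  have hεN : 8 / (N : ℝ) ≤ ε := by
    rw [div_le_iff₀ (by linarith)]
    nlinarith
  refine ⟨n * (N ^ 3 + 1) ^ n * (N ^ 7 * N) + n, ?_, fun F _ hF =>
    MenuAuction.Rev_le_RevC_of_natCast F hF hn hH (by omega) hHB hεN hε1.le le_rfl⟩
  have hnN : n ≤ N := by
    have : (n : ℝ) ≤ N := by linarith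
    exact_mod_cast this
  have hnat : n * (N ^ 3 + 1) ^ n * (N ^ 7 * N) + n ≤ N ^ (14 * n) := by
    have h1 : N ^ 3 + 1 ≤ N ^ 4 := by
      have : 1 ≤ N ^ 3 := Nat.one_le_pow _ _ (by omega)
      rw [pow_succ N 3]
      nlinarith
    calc n * (N ^ 3 + 1) ^ n * (N ^ 7 * N) + n
        ≤ N * (N ^ 4) ^ n * (N ^ 7 * N) + N * (N ^ 4) ^ n * (N ^ 7 * N) := by
          refine add_le_add (by gcongr) (hnN.trans ?_)
          rw [mul_assoc]
          exact Nat.le_mul_of_pos_right _ (by positivity)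
      _ = 2 * N ^ (4 * n + 9) := by ring
      _ ≤ N * N ^ (4 * n + 9) := by gcongr; omega
      _ = N ^ (4 * n + 10) := by ring
      _ ≤ N ^ (14 * n) := Nat.pow_le_pow_right (by omega) (by omega)
  calc ((n * (N ^ 3 + 1) ^ n * (N ^ 7 * N) + n : ℕ) : ℝ) ≤ ((N ^ (14 * n) : ℕ) : ℝ) := by
        exact_mod_cast hnat
    _ = (N : ℝ) ^ (14 * n) := by push_cast; rfl
    _ ≤ (B ^ 5) ^ (14 * n) := pow_le_pow_left₀ (by linarith) hNB5 _
    _ = B ^ (70 * n) := by rw [← pow_mul]; congr 1; ring
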